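/- Let $G=(S,A,\mathit{Act},\delta,s_0)$ be a Markov decision process: $S$ and $A$ are finite sets of states and actions, the non-empty sets $\mathit{Act}(s)$, $s\in S$, of actions enabled in $s$ form a partition of $A$, $\delta(a)$ is a probability distribution on $S$ for every $a\in A$, and $s_0\in S$ is the initial state. Assume that $G$ is strongly connected, i.e. $S\cup A$ is a maximal end component of $G$. (A set $T\cup B$ with $\emptyset\ne T\subseteq S$ and $B\subseteq\bigcup_{t\in T}\mathit{Act}(t)$ is an end component if $\delta(a)(s')>0$ with $a\in B$ implies $s'\in T$, and every two states of $T$ are connected by a path whose states are in $T$ and whose actions are in $B$; it is maximal if it is maximal under inclusion.) A Markov strategy is a triple $\xi=(\sigma_u,\sigma_n,\alpha)$ with memory $\mathbb N$, where $\sigma_n(s,m)$ is a probability distribution on $\mathit{Act}(s)$ for $s\in S$, $m\in\mathbb N$, the memory update $\sigma_u(a,s,m)$ is the Dirac distribution at $m+1$, and $\alpha$ is an initial distribution on $\mathbb N$. Its play is the Markov chain on $S\times\mathbb N\times A$ with initial probabilities $\mu(s,m,a)=[s=s_0]\,\alpha(m)\,\sigma_n(s,m)(a)$ and transition probabilities $P(s,m,a)(s',m',a')=\delta(a)(s')\,\sigma_u(a,s',m)(m')\,\sigma_n(s',m')(a')$;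 let $\mathbb P^\xi$ be its law on runs. For a run let $A_t$ be the action of its $t$-th location, $t\ge 1$, and for $a\in A$ put $$\mathrm{Freq}_a=\liminf_{T\to\infty}\frac1T\sum_{t=1}^T \mathbf 1[A_t=a].$$ Let $x=(x_a)_{a\in A}$ be non-negative real numbers that satisfy the recurrent-flow equation $$\sum_{a\in A}x_a\,\delta(a)(s)=\sum_{a\in\mathit{Act}(s)}x_a\qquad\text{for every }s\in S,$$ and let $\sum_{a\in A}x_a>0$. (The support of $x$ need not be connected.) Then there is a Markov strategy $\xi$ such that, for every $a\in A$, $\mathbb P^\xi$-almost surely $$\mathrm{Freq}_a=\frac{x_a}{\sum_{b\in A}x_b}.$$ -/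

import Mathlib

open MeasureTheory ProbabilityTheory Filter

noncomputable section

/-! ## Markov chains -/

/-- A Markov chain: an initial distribution and a probabilistic transition function on a countable
set `L` of locations. -/
structure MarkovChain (L : Type*) [Countable L] where
  init : PMF L
  trans : L → PMF L

namespace MarkovChain

variable {L : Type*} [Countable L] [MeasurableSpace L] [DiscreteMeasurableSpace L]

/-- The kernel that draws location number `n + 1` given the locations number `0, …, n`;
it only looks at location number `n`. -/
def stepKernel (C : MarkovChain L) (n : ℕ) : Kernel ((i : Finset.Iic n) → L) L where
  toFun h := (C.trans (h ⟨n, Finset.mem_Iic.2 le_rfl⟩)).toMeasure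
  measurable' := (Measurable.of_discrete (f := fun l => (C.trans l).toMeasure)).comp
    (measurable_pi_apply _)

instance (C : MarkovChain L) (n : ℕ) : IsMarkovKernel (C.stepKernel n) :=
  ⟨fun h => PMF.toMeasure.isProbabilityMeasure (C.trans (h ⟨n, Finset.mem_Iic.2 le_rfl⟩))⟩

/-- The probability measure on the runs (infinite sequences of locations) of a Markov chain.
The first location of a run `ω` is `ω 0`. -/
def law (C : MarkovChain L) : Measure (ℕ → L) :=
  Kernel.trajMeasure (X := fun _ => L) C.init.toMeasure C.stepKernel

end MarkovChain

/-! ## Markov decision processes -/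

/-- A Markov decision process with states `S` and actions `A`; both are finite wherever this is
used. -/
structure MDP (S A : Type*) where
  /-- the actions enabled in a state -/
  act : S → Finset A
  act_nonempty : ∀ s, (act s).Nonempty
  /-- the sets `act s` partition `A` -/
  act_partition : ∀ a, ∃! s, a ∈ act s
  /-- the distribution of the successor state -/
  δ : A → PMF S
  /-- the initial state -/
  s₀ : S

namespace MDP

variable {S A : Type*}

/-! ### End components -/

/-- One step `s a s'` of a path all of whose states are in `T` and whose actions are in `B`. -/
def StepIn (G : MDP S A) (T : Set S) (B : Set A) (s s' : S) : Prop :=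
  s ∈ T ∧ s' ∈ T ∧ ∃ a ∈ B, a ∈ G.act s ∧ 0 < G.δ a s'

/-- `T ∪ B` is an end component. -/
structure IsEndComponent (G : MDP S A) (T : Set S) (B : Set A) : Prop where
  nonempty : T.Nonempty
  enabled : ∀ a ∈ B, ∃ t ∈ T, a ∈ G.act t
  closed : ∀ a ∈ B, ∀ s', 0 < G.δ a s' → s' ∈ T
  connected : ∀ s ∈ T, ∀ t ∈ T, Relation.ReflTransGen (G.StepIn T B) s t

/-- `T ∪ B` is a maximal end component. -/
def IsMEC (G : MDP S A) (T : Set S) (B : Set A) : Prop :=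
  G.IsEndComponent T B ∧
    ∀ T' B', G.IsEndComponent T' B' → T ⊆ T' → B ⊆ B' → T' = T ∧ B' = B

/-- The set of all states and all actions is a maximal end component. -/
def StronglyConnected (G : MDP S A) : Prop :=
  G.IsMEC Set.univ Set.univ

/-! ### Strategies and plays -/

/-- A (stochastic-update, randomized) strategy with countable memory `M`. -/
structure Strategy (G : MDP S A) (M : Type*) [Countable M] where
  /-- memory update `σ_u` -/
  update : A → S → M → PMF M
  /-- next move `σ_n` -/
  next : S → M → PMF A
  next_enabled : ∀ s m a, 0 < next s m a → a ∈ G.act s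
  /-- initial distribution `α` on the memory -/
  init : PMF M

/-- A Markov strategy: the memory is a counter, which every update increases by one. -/
def Strategy.IsMarkov {G : MDP S A} (σ : G.Strategy ℕ) : Prop :=
  ∀ a s n, σ.update a s n (n + 1) = 1

/-- The locations `(s, m, a)` of a play. -/
@[ext]
structure Location (S M A : Type*) where
  state : S
  mem : M
  action : A

instance {M : Type*} [Countable S] [Countable M] [Countable A] : Countable (Location S M A) :=
  Function.Injective.countable (f := fun l : Location S M A => (l.state, l.mem, l.action))
    fun l l' h => by
      simp only [Prod.mk.injEq] at h
      exact Location.ext h.1 h.2.1 h.2.2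

instance {M : Type*} : MeasurableSpace (Location S M A) := ⊤

instance {M : Type*} : DiscreteMeasurableSpace (Location S M A) := ⟨fun _ => trivial⟩

variable {M : Type*} [Countable M]

/-- The location reached by choosing memory `m` from `μ` in state `s` and then the next move. -/
def Strategy.enter {G : MDP S A} (σ : G.Strategy M) (s : S) (μ : PMF M) : PMF (Location S M A) :=
  μ.bind fun m => (σ.next s m).map fun a => ⟨s, m, a⟩

/-- The play `G^σ`; `play_init_apply` and `play_trans_apply` give its probabilities. -/
def play [Countable S] [Countable A] (G : MDP S A) (σ : G.Strategy M) :
    MarkovChain (Location S M A) where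
  init := σ.enter G.s₀ σ.init
  trans l := (G.δ l.action).bind fun s' => σ.enter s' (σ.update l.action s' l.mem)

theorem Strategy.enter_apply [DecidableEq S] {G : MDP S A} (σ : G.Strategy M) (s₁ : S) (μ : PMF M)
    (s : S) (m : M) (a : A) :
    σ.enter s₁ μ ⟨s, m, a⟩ = (if s = s₁ then 1 else 0) * μ m * σ.next s m a := by
  classical
  simp only [Strategy.enter, PMF.bind_apply, PMF.map_apply, Location.mk.injEq]
  rw [tsum_eq_single m]
  · rw [tsum_eq_single a]
    · by_cases h : s = s₁ <;> simp [h]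
    · intro b hb
      simp [Ne.symm hb]
  · intro m' hm'
    simp [Ne.symm hm']

theorem play_init_apply [Countable S] [Countable A] [DecidableEq S] (G : MDP S A)
    (σ : G.Strategy M) (s : S) (m : M) (a : A) :
    (G.play σ).init ⟨s, m, a⟩ = (if s = G.s₀ then 1 else 0) * σ.init m * σ.next s m a :=
  σ.enter_apply _ _ _ _ _

theorem play_trans_apply [Countable S] [Countable A] (G : MDP S A)
    (σ : G.Strategy M) (s : S) (m : M) (a : A) (s' : S) (m' : M) (a' : A) :
    (G.play σ).trans ⟨s, m, a⟩ ⟨s', m', a'⟩ =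
      G.δ a s' * σ.update a s' m m' * σ.next s' m' a' := by
  classical
  simp only [play, PMF.bind_apply, Strategy.enter_apply]
  rw [tsum_eq_single s']
  · simp [mul_assoc]
  · intro t ht
    simp [Ne.symm ht]

/-! ### Long-run averages and the recurrent flow -/

/-- The limit-inferior average `lr_inf(r)` of a reward `r` along a run of a play. -/
def lrInf (r : A → ℝ) (ω : ℕ → Location S M A) : ℝ :=
  liminf (fun T : ℕ => (1 / (T : ℝ)) * ∑ t ∈ Finset.range T, r (ω t).action) atTop

/-- The frequency `Freq_a` of the action `a` on a run: the limit-inferior average of the indicator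
function of `a`. -/
def freq (a : A) (ω : ℕ → Location S M A) : ℝ :=
  lrInf (Set.indicator {a} 1) ω

/-- The recurrent-flow equation: in every state, the inflow equals the outflow. -/
def RecurrentFlow [Fintype A] (G : MDP S A) (x : A → ℝ) : Prop :=
  ∀ s, ∑ a, x a * (G.δ a s).toReal = ∑ a ∈ G.act s, x a

end MDP

end

set_option linter.unusedSectionVars false

noncomputable section

/-! ## Fourth moments of sums of bounded martingale differences -/

section Moments

variable {Ω : Type*} [MeasurableSpace Ω] {μ : Measure Ω}

/-! The support of `x` may be disconnected, so memoryless play in proportion to `x` need not realise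
`x`. Strong connectedness yields a strictly positive recurrent flow `y`; each `w k = x + y / (k +
1)` is then a positive recurrent flow. Choosing actions in proportion to `w k` makes the actions an
irreducible chain with matrix `Q k`, whose stationary distribution is the normalised `w k`, and
these converge to the normalised `x`. The strategy uses `w (κ m)` at time `m`, where `κ` tends to
infinity slowly.

No mixing estimate is needed. For `f` the indicator of an action with stationary mean `p k`, solve
the Poisson equation `h k - Q k h k = f - p k` (`exists_poisson`). With `k = κ (n + 1)`, `f(A_n)` is
`p k`, plus the martingale difference `h k (A_{n+1}) - (Q k h k)(A_n)`, plus `h k (A_n) - h k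
(A_{n+1})`. The first terms converge on average by Cesàro, the second average to zero by a
fourth-moment bound (`ae_tendsto_deviationSum_div`), and the third nearly telescope
(`abs_sum_sub_le`). The solutions `h k` may grow arbitrarily fast in `k`; `exists_slow_schedule`
picks `κ` to keep this growth harmless. -/

theorem ae_tendsto_zero_of_summable_integral {f : ℕ → Ω → ℝ} {b : ℕ → ℝ}
    (hf : ∀ n, Integrable (f n) μ) (hf0 : ∀ n ω, 0 ≤ f n ω) (hb : Summable b)
    (hfb : ∀ n, ∫ ω, f n ω ∂μ ≤ b n) :
    ∀ᵐ ω ∂μ, Tendsto (fun n => f n ω) atTop (nhds 0) := by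
  have hm (n) : AEMeasurable (fun ω => ENNReal.ofReal (f n ω)) μ := (hf n).aemeasurable.ennreal_ofReal
  -- The sum of the series has finite integral, so it is finite almost everywhere and its terms
  -- vanish in the limit.
  have h : ∫⁻ ω, ∑' n, ENNReal.ofReal (f n ω) ∂μ ≠ ⊤ := by
    rw [lintegral_tsum hm]
    refine ne_top_of_le_ne_top hb.tsum_ofReal_ne_top (ENNReal.tsum_le_tsum fun n => ?_)
    rw [← ofReal_integral_eq_lintegral_ofReal (hf n) (ae_of_all _ (hf0 n))]
    exact ENNReal.ofReal_le_ofReal (hfb n)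
  filter_upwards [ae_lt_top' (AEMeasurable.tsum hm) h] with ω hω
  have := (ENNReal.tendsto_toReal ENNReal.zero_ne_top).comp
    (ENNReal.tendsto_atTop_zero_of_tsum_ne_top hω.ne)
  simpa [Function.comp_def, ENNReal.toReal_ofReal, hf0] using this

variable [IsProbabilityMeasure μ]

theorem integrable_of_measurable_of_abs_le {f : Ω → ℝ} (hf : Measurable f) {C : ℝ}
    (hC : ∀ ω, |f ω| ≤ C) : Integrable f μ :=
  Integrable.of_bound hf.aestronglyMeasurable C (ae_of_all _ hC)

theorem integral_add_sq_le {S D : Ω → ℝ} (hS : Measurable S) (hD : Measurable D) {B d : ℝ}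
    (hB : ∀ ω, |S ω| ≤ B) (hd : ∀ ω, |D ω| ≤ d) (hSD : ∫ ω, S ω * D ω ∂μ = 0) :
    ∫ ω, (S ω + D ω) ^ 2 ∂μ ≤ ∫ ω, S ω ^ 2 ∂μ + d ^ 2 := by
  have i1 : Integrable (fun ω => S ω ^ 2) μ :=
    integrable_of_measurable_of_abs_le (hS.pow_const 2) (C := B ^ 2) fun ω => by
      rw [abs_pow]; exact pow_le_pow_left₀ (abs_nonneg _) (hB ω) 2
  have i2 : Integrable (fun ω => S ω * D ω) μ :=
    integrable_of_measurable_of_abs_le (hS.mul hD) (C := B * d) fun ω => by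
      rw [abs_mul]
      exact mul_le_mul (hB ω) (hd ω) (abs_nonneg _) ((abs_nonneg _).trans (hB ω))
  have i3 : Integrable (fun _ : Ω => d ^ 2) μ := integrable_const _
  calc ∫ ω, (S ω + D ω) ^ 2 ∂μ
      ≤ ∫ ω, (S ω ^ 2 + 2 * (S ω * D ω) + d ^ 2) ∂μ := by
        refine integral_mono_of_nonneg (ae_of_all _ fun ω => sq_nonneg _)
          ((i1.add (i2.const_mul 2)).add i3) (ae_of_all _ fun ω => ?_)
        have : D ω ^ 2 ≤ d ^ 2 := by
          rw [← sq_abs]; exact pow_le_pow_left₀ (abs_nonneg _) (hd ω) 2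
        dsimp only
        linarith [add_sq (S ω) (D ω)]
    _ = ∫ ω, S ω ^ 2 ∂μ + d ^ 2 := by
        have i4 : Integrable (fun ω => S ω ^ 2 + 2 * (S ω * D ω)) μ := i1.add (i2.const_mul 2)
        rw [integral_add i4 i3, integral_add i1 (i2.const_mul 2),
          integral_const_mul, hSD]
        simp

/-- Expand the power; orthogonality removes the term with `S ^ 3 * D`. From `(D * (S - D)) ^ 2 ≥ 0`
comes `4 S D³ ≤ 2 S² D² + 2 D⁴`, which turns the coefficients 6 and 1 into 8 and 3. -/
theorem integral_add_pow_four_le {S D : Ω → ℝ} (hS : Measurable S) (hD : Measurable D) {B d : ℝ}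
    (hB : ∀ ω, |S ω| ≤ B) (hd : ∀ ω, |D ω| ≤ d) (hSD : ∫ ω, S ω ^ 3 * D ω ∂μ = 0) :
    ∫ ω, (S ω + D ω) ^ 4 ∂μ
      ≤ ∫ ω, S ω ^ 4 ∂μ + 8 * d ^ 2 * ∫ ω, S ω ^ 2 ∂μ + 3 * d ^ 4 := by
  have ip (k : ℕ) : Integrable (fun ω => S ω ^ k) μ :=
    integrable_of_measurable_of_abs_le (hS.pow_const k) (C := B ^ k) fun ω => by
      rw [abs_pow]; exact pow_le_pow_left₀ (abs_nonneg _) (hB ω) k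
  have i2 : Integrable (fun ω => S ω ^ 3 * D ω) μ :=
    integrable_of_measurable_of_abs_le ((hS.pow_const 3).mul hD) (C := B ^ 3 * d) fun ω => by
      rw [abs_mul, abs_pow]
      exact mul_le_mul (pow_le_pow_left₀ (abs_nonneg _) (hB ω) 3) (hd ω) (abs_nonneg _)
        (pow_nonneg ((abs_nonneg _).trans (hB ω)) 3)
  have i3 : Integrable (fun _ : Ω => 3 * d ^ 4) μ := integrable_const _
  have i5 : Integrable (fun ω => S ω ^ 4 + 4 * (S ω ^ 3 * D ω)) μ := (ip 4).add (i2.const_mul 4)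
  have i4 : Integrable (fun ω => S ω ^ 4 + 4 * (S ω ^ 3 * D ω) + 8 * d ^ 2 * S ω ^ 2) μ :=
    i5.add ((ip 2).const_mul (8 * d ^ 2))
  calc ∫ ω, (S ω + D ω) ^ 4 ∂μ
      ≤ ∫ ω, (S ω ^ 4 + 4 * (S ω ^ 3 * D ω) + 8 * d ^ 2 * S ω ^ 2 + 3 * d ^ 4) ∂μ := by
        refine integral_mono_of_nonneg (ae_of_all _ fun ω => by positivity)
          (i4.add i3) (ae_of_all _ fun ω => ?_)
        have h2 : D ω ^ 2 ≤ d ^ 2 := by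
          rw [← sq_abs]; exact pow_le_pow_left₀ (abs_nonneg _) (hd ω) 2
        have h4 : D ω ^ 4 ≤ d ^ 4 := by
          have := pow_le_pow_left₀ (sq_nonneg (D ω)) h2 2
          rwa [← pow_mul, ← pow_mul] at this
        have h5 : S ω ^ 2 * D ω ^ 2 ≤ S ω ^ 2 * d ^ 2 :=
          mul_le_mul_of_nonneg_left h2 (sq_nonneg _)
        have h6 : 0 ≤ (D ω * (S ω - D ω)) ^ 2 := sq_nonneg _
        dsimp only
        nlinarith [h4, h5, h6]
    _ = _ := by
        rw [integral_add i4 i3, integral_add i5 ((ip 2).const_mul (8 * d ^ 2)), integral_add (ip 4) (i2.const_mul 4),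
          integral_const_mul, integral_const_mul, hSD]
        simp
end Moments

theorem tendsto_zero_of_pow_four {u : ℕ → ℝ} (h : Tendsto (fun n => u n ^ 4) atTop (nhds 0)) :
    Tendsto u atTop (nhds 0) := by
  have h0 := (Real.continuous_sqrt.tendsto _).comp ((Real.continuous_sqrt.tendsto _).comp h)
  refine (tendsto_zero_iff_abs_tendsto_zero _).2 ((h0.congr fun n => ?_).trans (by simp))
  simp only [Function.comp]
  rw [show ∀ y : ℝ, y ^ 4 = (y ^ 2) ^ 2 from fun y => by ring, Real.sqrt_sq (sq_nonneg _),
    Real.sqrt_sq_eq_abs]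

/-! ## A law of large numbers along a Markov chain -/

namespace MarkovChain

variable {L : Type*} [Countable L] [MeasurableSpace L] [DiscreteMeasurableSpace L]

instance (C : MarkovChain L) : IsProbabilityMeasure C.law := by
  have : IsProbabilityMeasure C.init.toMeasure := PMF.toMeasure.isProbabilityMeasure _
  unfold law
  infer_instance

/-- The deviation of `g` at location number `n + 1` from its expectation given the past. -/
def deviation (C : MarkovChain L) (g : L → ℝ) (n : ℕ) (ω : ℕ → L) : ℝ :=
  g (ω (n + 1)) - ∫ l, g l ∂(C.trans (ω n)).toMeasure

theorem measurable_deviation (C : MarkovChain L) (g : L → ℝ) (n : ℕ) :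
    Measurable (C.deviation g n) :=
  ((Measurable.of_discrete (f := g)).comp (measurable_pi_apply _)).sub
    ((Measurable.of_discrete (f := fun l' => ∫ l, g l ∂(C.trans l').toMeasure)).comp
      (measurable_pi_apply _))

theorem abs_deviation_le (C : MarkovChain L) {g : L → ℝ} {c : ℝ} (hg : ∀ l, |g l| ≤ c) (n : ℕ)
    (ω : ℕ → L) : |C.deviation g n ω| ≤ 2 * c := by
  have : IsProbabilityMeasure (C.trans (ω n)).toMeasure := PMF.toMeasure.isProbabilityMeasure _
  have h : |∫ l, g l ∂(C.trans (ω n)).toMeasure| ≤ c := by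
    simpa using norm_integral_le_of_norm_le_const (μ := (C.trans (ω n)).toMeasure)
      (f := g) (ae_of_all _ hg)
  calc |C.deviation g n ω| ≤ |g (ω (n + 1))| + |∫ l, g l ∂(C.trans (ω n)).toMeasure| := abs_sub _ _
    _ ≤ 2 * c := by linarith [hg (ω (n + 1))]

/-- The martingale property: disintegrate the law of the first `n + 2` locations over the past; the
inner integral of the deviation vanishes. -/
theorem integral_mul_deviation (C : MarkovChain L) {g : L → ℝ} {c : ℝ} (hg : ∀ l, |g l| ≤ c)
    (n : ℕ) {Ψ : (ℕ → L) → ℝ} (hΨ : Measurable Ψ) {B : ℝ} (hB : ∀ ω, |Ψ ω| ≤ B)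
    (hdep : ∀ ω ω', (∀ i ≤ n, ω i = ω' i) → Ψ ω = Ψ ω') :
    ∫ ω, Ψ ω * C.deviation g n ω ∂C.law = 0 := by
  have : IsProbabilityMeasure C.init.toMeasure := PMF.toMeasure.isProbabilityMeasure _
  let r : (ℕ → L) → ((i : Finset.Iic n) → L) := Preorder.frestrictLe (π := fun _ => L) n
  have hr : Measurable r := by fun_prop
  let last : Finset.Iic n := ⟨n, Finset.mem_Iic.2 le_rfl⟩
  -- Continues a finite past to a run so that `Ψ` can be evaluated; by `hdep` the filler after time
  -- `n` is immaterial.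
  let ext : ((i : Finset.Iic n) → L) → ℕ → L := fun h i =>
    if hi : i ≤ n then h ⟨i, Finset.mem_Iic.2 hi⟩ else h last
  have hext : Measurable ext := by
    refine measurable_pi_iff.2 fun i => ?_
    by_cases hi : i ≤ n
    · simpa [ext, hi] using measurable_pi_apply _
    · simpa [ext, hi] using measurable_pi_apply _
  have hΨr (ω) : Ψ (ext (r ω)) = Ψ ω := hdep _ _ fun i hi => by simp [ext, hi, r]
  let e : ((i : Finset.Iic n) → L) → ℝ := fun h => ∫ l, g l ∂(C.trans (h last)).toMeasure
  have he : Measurable e :=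
    (Measurable.of_discrete (f := fun l' => ∫ l, g l ∂(C.trans l').toMeasure)).comp
      (measurable_pi_apply _)
  have hec (h) : |e h| ≤ c := by
    have : IsProbabilityMeasure (C.trans (h last)).toMeasure := PMF.toMeasure.isProbabilityMeasure _
    simpa using norm_integral_le_of_norm_le_const (μ := (C.trans (h last)).toMeasure)
      (f := g) (ae_of_all _ hg)
  let F : ((i : Finset.Iic n) → L) × L → ℝ := fun p => Ψ (ext p.1) * (g p.2 - e p.1)
  have hF : Measurable F :=
    (hΨ.comp (hext.comp measurable_fst)).mul
      (((Measurable.of_discrete (f := g)).comp measurable_snd).sub (he.comp measurable_fst))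
  have hFB (p) : |F p| ≤ B * (2 * c) := by
    rw [abs_mul]
    refine mul_le_mul (hB _) ((abs_sub _ _).trans ?_) (abs_nonneg _) ((abs_nonneg _).trans (hB (ext p.1)))
    linarith [hg p.2, hec p.1]
  have key := Kernel.map_frestrictLe_trajMeasure_compProd_eq_map_trajMeasure
    (X := fun _ => L) (μ₀ := C.init.toMeasure) (κ := C.stepKernel) (a := n)
  have hm : Measurable fun ω : ℕ → L => (r ω, ω (n + 1)) := hr.prodMk (measurable_pi_apply _)
  have h1 : ∫ ω, Ψ ω * C.deviation g n ω ∂C.law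
      = ∫ p, F p ∂(C.law.map fun ω => (r ω, ω (n + 1))) := by
    rw [integral_map hm.aemeasurable hF.aestronglyMeasurable]
    refine integral_congr_ae (ae_of_all _ fun ω => ?_)
    simp only [F, hΨr]
    rfl
  have : IsProbabilityMeasure (C.law.map r) := Measure.isProbabilityMeasure_map hr.aemeasurable
  have h2 : (C.law.map fun ω => (r ω, ω (n + 1))) = (C.law.map r) ⊗ₘ C.stepKernel n := key.symm
  rw [h1, h2, Measure.integral_compProd (integrable_of_measurable_of_abs_le hF hFB)]
  refine integral_eq_zero_of_ae (ae_of_all _ fun h => ?_)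
  have hp : IsProbabilityMeasure (C.trans (h last)).toMeasure := PMF.toMeasure.isProbabilityMeasure _
  change ∫ l, Ψ (ext h) * (g l - e h) ∂(C.trans (h last)).toMeasure = 0
  rw [integral_const_mul, integral_sub
    (integrable_of_measurable_of_abs_le Measurable.of_discrete hg) (integrable_const _)]
  simp [e]

/-- The sum of the first `T` deviations of the functions `g n`. -/
def deviationSum (C : MarkovChain L) (g : ℕ → L → ℝ) (T : ℕ) (ω : ℕ → L) : ℝ :=
  ∑ n ∈ Finset.range T, C.deviation (g n) n ω

theorem measurable_deviationSum (C : MarkovChain L) (g : ℕ → L → ℝ) (T : ℕ) :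
    Measurable (C.deviationSum g T) :=
  Finset.measurable_sum _ fun n _ => C.measurable_deviation (g n) n

theorem deviationSum_congr (C : MarkovChain L) (g : ℕ → L → ℝ) (T : ℕ) {ω ω' : ℕ → L}
    (h : ∀ i ≤ T, ω i = ω' i) : C.deviationSum g T ω = C.deviationSum g T ω' := by
  refine Finset.sum_congr rfl fun n hn => ?_
  have := Finset.mem_range.1 hn
  simp only [deviation, h n this.le, h (n + 1) this]

theorem abs_deviationSum_le (C : MarkovChain L) {g : ℕ → L → ℝ} {c : ℝ} {T : ℕ}
    (hg : ∀ n < T, ∀ l, |g n l| ≤ c) (ω : ℕ → L) : |C.deviationSum g T ω| ≤ T * (2 * c) := by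
  refine (Finset.abs_sum_le_sum_abs _ _).trans ?_
  refine (Finset.sum_le_sum fun n hn =>
    C.abs_deviation_le (hg n (Finset.mem_range.1 hn)) n ω).trans ?_
  simp

theorem integral_deviationSum_sq_le (C : MarkovChain L) {g : ℕ → L → ℝ} {c : ℝ} (T : ℕ)
    (hg : ∀ n < T, ∀ l, |g n l| ≤ c) :
    ∫ ω, C.deviationSum g T ω ^ 2 ∂C.law ≤ T * (2 * c) ^ 2 := by
  induction T with
  | zero => simp [deviationSum]
  | succ T ih =>
    have hg' : ∀ n < T, ∀ l, |g n l| ≤ c := fun n hn => hg n (hn.trans T.lt_succ_self)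
    have h := integral_add_sq_le (μ := C.law) (C.measurable_deviationSum g T)
      (C.measurable_deviation (g T) T) (C.abs_deviationSum_le hg')
      (C.abs_deviation_le (hg T T.lt_succ_self) T)
      (C.integral_mul_deviation (hg T T.lt_succ_self) T (C.measurable_deviationSum g T)
        (C.abs_deviationSum_le hg') fun _ _ h => C.deviationSum_congr g T h)
    simp only [deviationSum, Finset.sum_range_succ] at h ih ⊢
    push_cast
    linarith [ih hg']

/-- With `d = 2c`, one more summand adds at most `(8T + 3) d⁴`, while `4T² d⁴` grows by `(8T + 4)
d⁴`. -/
theorem integral_deviationSum_pow_four_le (C : MarkovChain L) {g : ℕ → L → ℝ} {c : ℝ} (T : ℕ)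
    (hg : ∀ n < T, ∀ l, |g n l| ≤ c) :
    ∫ ω, C.deviationSum g T ω ^ 4 ∂C.law ≤ 4 * (T : ℝ) ^ 2 * (2 * c) ^ 4 := by
  induction T with
  | zero => simp [deviationSum]
  | succ T ih =>
    have hg' : ∀ n < T, ∀ l, |g n l| ≤ c := fun n hn => hg n (hn.trans T.lt_succ_self)
    have h := integral_add_pow_four_le (μ := C.law) (C.measurable_deviationSum g T)
      (C.measurable_deviation (g T) T) (C.abs_deviationSum_le hg')
      (C.abs_deviation_le (hg T T.lt_succ_self) T)
      (C.integral_mul_deviation (hg T T.lt_succ_self) T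
        ((C.measurable_deviationSum g T).pow_const 3)
        (B := (T * (2 * c)) ^ 3)
        (fun ω => by
          rw [abs_pow]
          exact pow_le_pow_left₀ (abs_nonneg _) (C.abs_deviationSum_le hg' ω) 3)
        fun _ _ h => by simp only [C.deviationSum_congr g T h])
    have h2 := mul_le_mul_of_nonneg_left (C.integral_deviationSum_sq_le T hg')
      (by positivity : 0 ≤ 8 * (2 * c) ^ 2)
    have ih := ih hg'
    have h4 : 0 ≤ (2 * c) ^ 4 := by positivity
    simp only [deviationSum, Finset.sum_range_succ] at h ih h2 ⊢
    push_cast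
    nlinarith [ih, h, h2, h4]

/-- As `c n ^ 4` is at most of order `√n`, the fourth moments of the averages are of order `n ^
(-3/2)`, hence summable; the second-moment bound, of order `c² / n`, would not suffice. -/
theorem ae_tendsto_deviationSum_div (C : MarkovChain L) {g : ℕ → L → ℝ} {c : ℕ → ℝ}
    (hc : Monotone c) (hg : ∀ n l, |g n l| ≤ c n) {K : ℝ} (hcK : ∀ n, c n ^ 8 ≤ K * (n + 1)) :
    ∀ᵐ ω ∂C.law,
      Tendsto (fun n : ℕ => C.deviationSum g (n + 1) ω / ((n : ℝ) + 1)) atTop (nhds 0) := by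
  have hK : 0 ≤ K := by
    have := hcK 0
    have h8 : 0 ≤ c 0 ^ 8 := by positivity
    simp at this; linarith
  have hgc (n : ℕ) : ∀ m < n + 1, ∀ l, |g m l| ≤ c n := fun m hm l =>
    (hg m l).trans (hc (Nat.lt_succ_iff.1 hm))
  have hsum : Summable fun n : ℕ => 64 * √K * (1 / ((n : ℝ) + 1) ^ (3 / 2 : ℝ)) := by
    refine Summable.mul_left _ ?_
    have := (summable_nat_add_iff 1).2
      (Real.summable_one_div_nat_rpow (p := 3 / 2).2 (by norm_num))
    simpa using this
  have h := ae_tendsto_zero_of_summable_integral (μ := C.law)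
    (f := fun n ω => (C.deviationSum g (n + 1) ω / ((n : ℝ) + 1)) ^ 4) (fun n => by
      refine integrable_of_measurable_of_abs_le
        (((C.measurable_deviationSum g (n + 1)).div_const _).pow_const 4) (C := (2 * c n) ^ 4)
        fun ω => ?_
      rw [abs_pow]
      refine pow_le_pow_left₀ (abs_nonneg _) ?_ 4
      have hn : (0 : ℝ) < (n : ℝ) + 1 := by positivity
      rw [abs_div, abs_of_pos hn, div_le_iff₀ hn, mul_comm]
      simpa using C.abs_deviationSum_le (hgc n) ω) (fun n ω => by positivity) hsum (fun n => by
      have hn : (0 : ℝ) < (n : ℝ) + 1 := by positivity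
      simp only [div_pow]
      rw [integral_div, div_le_iff₀ (by positivity)]
      refine (C.integral_deviationSum_pow_four_le (n + 1) (hgc n)).trans ?_
      have h4 : c n ^ 4 ≤ √K * √((n : ℝ) + 1) := by
        rw [← Real.sqrt_mul hK]
        refine Real.le_sqrt_of_sq_le ?_
        rw [← pow_mul]
        exact hcK n
      have h5 : 1 / ((n : ℝ) + 1) ^ (3 / 2 : ℝ) * ((n : ℝ) + 1) ^ 4
          = ((n : ℝ) + 1) ^ 2 * √((n : ℝ) + 1) := by
        rw [Real.sqrt_eq_rpow, ← Real.rpow_natCast, ← Real.rpow_natCast, ← Real.rpow_add hn,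
          one_div, ← Real.rpow_neg hn.le, ← Real.rpow_add hn]
        norm_num
      rw [mul_assoc (64 * √K), h5]
      push_cast
      have := mul_le_mul_of_nonneg_left h4 (by positivity : 0 ≤ 64 * ((n : ℝ) + 1) ^ 2)
      linarith)
  filter_upwards [h] with ω hω
  exact tendsto_zero_of_pow_four hω

end MarkovChain

/-! ## Irreducible stochastic matrices -/

/-- A stochastic matrix without a proper non-empty set of indices closed under its transitions. -/
structure IsIrreducibleStochastic {n : Type*} [Fintype n] (Q : Matrix n n ℝ) : Prop where
  nonneg : ∀ i j, 0 ≤ Q i j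
  row_sum : ∀ i, ∑ j, Q i j = 1
  eq_univ : ∀ Z : Set n, Z.Nonempty → (∀ i ∈ Z, ∀ j, 0 < Q i j → j ∈ Z) → Z = Set.univ

namespace IsIrreducibleStochastic

open Matrix

variable {n : Type*} [Fintype n] {Q : Matrix n n ℝ}

theorem mulVec_const (hQ : IsIrreducibleStochastic Q) (c : ℝ) : Q *ᵥ (fun _ => c) = fun _ => c := by
  ext i
  simp [mulVec, dotProduct, ← Finset.sum_mul, hQ.row_sum]

/-- Maximum principle: the set where `h` attains its maximum is closed under transitions. -/
theorem eq_const_of_mulVec_eq (hQ : IsIrreducibleStochastic Q) {h : n → ℝ} (hh : Q *ᵥ h = h)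
    (i j : n) : h i = h j := by
  obtain ⟨m, -, hm⟩ := Finset.exists_max_image Finset.univ h ⟨i, Finset.mem_univ i⟩
  have hZ := hQ.eq_univ {k | h k = h m} ⟨m, rfl⟩ fun k hk l hkl => by
    have hk' : h k = h m := hk
    have hsum : ∑ l, Q k l * (h m - h l) = 0 := by
      have := congrFun hh k
      simp only [mulVec, dotProduct] at this
      simp only [mul_sub, Finset.sum_sub_distrib, ← Finset.sum_mul, hQ.row_sum, this, hk']
      ring
    have h0 := (Finset.sum_eq_zero_iff_of_nonneg fun l _ => mul_nonneg (hQ.nonneg k l)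
      (sub_nonneg.2 (hm l (Finset.mem_univ l)))).1 hsum l (Finset.mem_univ l)
    rcases mul_eq_zero.1 h0 with h0 | h0
    · exact absurd h0 hkl.ne'
    · exact (sub_eq_zero.1 h0).symm
  have hi : i ∈ {k | h k = h m} := hZ ▸ Set.mem_univ i
  have hj : j ∈ {k | h k = h m} := hZ ▸ Set.mem_univ j
  exact hi.trans hj.symm

/-- Constants lie in the kernel of `1 - Q`, so there is a left null vector `u`. Entrywise `|u| ≤ |u|
Q`, and both sides have the same total, so `|u|` is invariant; its support is closed under
transitions, hence everything. -/
theorem exists_pos_vecMul_eq [Nonempty n] (hQ : IsIrreducibleStochastic Q) :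
    ∃ v : n → ℝ, (∀ i, 0 < v i) ∧ v ᵥ* Q = v := by
  classical
  have hdet : (1 - Q).det = 0 := by
    refine exists_mulVec_eq_zero_iff.1 ⟨fun _ => 1, ?_, ?_⟩
    · exact fun h => one_ne_zero (congrFun h (Classical.arbitrary n))
    · rw [sub_mulVec, one_mulVec, hQ.mulVec_const, sub_self]
  obtain ⟨u, hu, huQ⟩ := exists_vecMul_eq_zero_iff.2 hdet
  rw [vecMul_sub, vecMul_one, sub_eq_zero] at huQ
  have hle (j : n) : |u j| ≤ ((fun i => |u i|) ᵥ* Q) j := by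
    conv_lhs => rw [huQ]
    simp only [vecMul, dotProduct]
    refine (Finset.abs_sum_le_sum_abs _ _).trans_eq (Finset.sum_congr rfl fun i _ => ?_)
    rw [abs_mul, abs_of_nonneg (hQ.nonneg i j)]
  have htot : ∑ j, ((fun i => |u i|) ᵥ* Q) j = ∑ j, |u j| := by
    simp only [vecMul, dotProduct]
    rw [Finset.sum_comm]
    simp [← Finset.mul_sum, hQ.row_sum]
  have heq : (fun i => |u i|) ᵥ* Q = fun i => |u i| := by
    ext j
    exact ((Finset.sum_eq_sum_iff_of_le fun j _ => hle j).1 htot.symm j (Finset.mem_univ j)).symm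
  refine ⟨fun i => |u i|, fun i => ?_, heq⟩
  have hZ := hQ.eq_univ {i | 0 < |u i|} (by
    obtain ⟨i, hi⟩ := Function.ne_iff.1 hu
    exact ⟨i, abs_pos.2 hi⟩) fun i hi j hij => by
      have := congrFun heq j
      simp only [vecMul, dotProduct] at this
      rw [Set.mem_ofPred_eq, ← this]
      exact (mul_pos hi hij).trans_le (Finset.single_le_sum (f := fun i => |u i| * Q i j)
        (fun k _ => mul_nonneg (abs_nonneg _) (hQ.nonneg k j)) (Finset.mem_univ i))
  exact (hZ ▸ Set.mem_univ i : i ∈ {i | 0 < |u i|})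

/-- Solvability of the Poisson equation. -/
theorem exists_poisson (hQ : IsIrreducibleStochastic Q) {π : n → ℝ} (hπ : π ᵥ* Q = π)
    (hπ1 : ∑ i, π i = 1) (f : n → ℝ) :
    ∃ h : n → ℝ, ∀ i, h i - (Q *ᵥ h) i = f i - ∑ j, π j * f j := by
  classical
  let M : (n → ℝ) →ₗ[ℝ] (n → ℝ) := LinearMap.id - Q.mulVecLin
  let p : (n → ℝ) →ₗ[ℝ] ℝ := dotProductBilin ℝ ℝ π
  have hp (v) : p v = ∑ i, π i * v i := rfl
  have hle : LinearMap.range M ≤ LinearMap.ker p := by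
    rintro _ ⟨v, rfl⟩
    change π ⬝ᵥ (v - Q *ᵥ v) = 0
    rw [dotProduct_sub, dotProduct_mulVec, hπ, sub_self]
  have hone : p (fun _ => 1) = 1 := by simp [hp, hπ1]
  have hkerM : Module.finrank ℝ (LinearMap.ker M) ≤ 1 := by
    refine finrank_le_one (⟨fun _ => 1, ?_⟩ : LinearMap.ker M) fun w => ?_
    · change (fun _ => (1 : ℝ)) - Q *ᵥ (fun _ => 1) = 0
      rw [hQ.mulVec_const, sub_self]
    · have hw : (w : n → ℝ) - Q *ᵥ w = 0 := w.2
      have hw := hQ.eq_const_of_mulVec_eq (sub_eq_zero.1 hw).symm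
      by_cases hn : Nonempty n
      · obtain ⟨i⟩ := hn
        refine ⟨(w : n → ℝ) i, Subtype.ext (funext fun j => ?_)⟩
        simpa using hw i j
      · exact ⟨0, Subtype.ext (funext fun j => absurd ⟨j⟩ hn)⟩
  have hranp : Module.finrank ℝ (LinearMap.range p) = 1 := by
    rw [LinearMap.range_eq_top.2 fun c => ⟨c • fun _ => 1, by rw [map_smul, hone]; simp⟩]
    simp
  have h1 := M.finrank_range_add_finrank_ker
  have h2 := p.finrank_range_add_finrank_ker
  -- The kernel of `M` is at most one-dimensional, so its range has at least the dimension of the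
  -- hyperplane that contains it.
  have hran : LinearMap.range M = LinearMap.ker p :=
    Submodule.eq_of_le_of_finrank_le hle (by omega)
  have hf : (f - fun _ => ∑ j, π j * f j) ∈ LinearMap.ker p := by
    rw [LinearMap.mem_ker, map_sub, hp, hp, ← Finset.sum_mul, hπ1, one_mul, sub_self]
  rw [← hran] at hf
  obtain ⟨h, hh⟩ := hf
  exact ⟨h, fun i => congrFun hh i⟩

end IsIrreducibleStochastic

/-! ## The chain of actions of a memoryless strategy -/

namespace MDP

open Matrix

variable {S A : Type*} (G : MDP S A)

open Classical in
/-- The probability with which the action `a` is chosen in the state `s` if the actions enabled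
in `s` are chosen in proportion to the weights `w`. -/
def choice (w : A → ℝ) (s : S) (a : A) : ℝ :=
  if a ∈ G.act s then w a / ∑ b ∈ G.act s, w b else 0

variable {G} {w : A → ℝ}

theorem sum_act_pos (hw : ∀ a, 0 < w a) (s : S) : 0 < ∑ b ∈ G.act s, w b :=
  Finset.sum_pos (fun b _ => hw b) (G.act_nonempty s)

theorem choice_nonneg (hw : ∀ a, 0 < w a) (s : S) (a : A) : 0 ≤ G.choice w s a := by
  unfold choice
  split_ifs
  · exact div_nonneg (hw a).le (sum_act_pos hw s).le
  · rfl

theorem choice_pos (hw : ∀ a, 0 < w a) {s : S} {a : A} (ha : a ∈ G.act s) :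
    0 < G.choice w s a := by
  simpa [choice, ha] using div_pos (hw a) (sum_act_pos hw s)

theorem sum_act_choice (hw : ∀ a, 0 < w a) (s : S) : ∑ a ∈ G.act s, G.choice w s a = 1 := by
  rw [← div_self (sum_act_pos (G := G) hw s).ne', Finset.sum_div]
  exact Finset.sum_congr rfl fun a ha => by simp [choice, ha]

theorem sum_choice [Fintype A] (hw : ∀ a, 0 < w a) (s : S) : ∑ a, G.choice w s a = 1 := by
  rw [← sum_act_choice hw s]
  exact (Finset.sum_subset (Finset.subset_univ _) fun a _ ha => by simp [choice, ha]).symm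

theorem sum_δ [Fintype S] (a : A) : ∑ s, (G.δ a s).toReal = 1 := by
  rw [← ENNReal.toReal_sum fun s _ => (G.δ a).apply_ne_top s, ← tsum_fintype (L := .unconditional S), PMF.tsum_coe]
  rfl

variable (G) in
/-- The transition matrix of the sequence of actions when actions are chosen in proportion
to `w`. -/
def actionMatrix [Fintype S] (w : A → ℝ) : Matrix A A ℝ :=
  fun a a' => ∑ s, (G.δ a s).toReal * G.choice w s a'

/-- In a strongly connected MDP, a set of actions that contains all actions enabled in any
successor of its members is everything. -/
theorem StronglyConnected.eq_univ (hG : G.StronglyConnected) {Z : Set A} (hne : Z.Nonempty)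
    (hZ : ∀ a ∈ Z, ∀ s, 0 < G.δ a s → ∀ a' ∈ G.act s, a' ∈ Z) : Z = Set.univ := by
  obtain ⟨a, ha⟩ := hne
  obtain ⟨s, hs⟩ := (G.δ a).support_nonempty
  have hs : 0 < G.δ a s := pos_iff_ne_zero.2 hs
  have key (t : S) : ∀ a' ∈ G.act t, a' ∈ Z := by
    have hst := hG.1.connected s trivial t trivial
    induction hst with
    | refl => exact hZ a ha s hs
    | tail _ h ih =>
      obtain ⟨-, -, b, -, hb, hbt⟩ := h
      exact hZ b (ih b hb) _ hbt
  refine Set.eq_univ_of_forall fun a' => ?_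
  obtain ⟨t, ht, -⟩ := G.act_partition a'
  exact key t a' ht

variable [Fintype S] [Fintype A]

theorem StronglyConnected.isIrreducibleStochastic (hG : G.StronglyConnected)
    (hw : ∀ a, 0 < w a) : IsIrreducibleStochastic (G.actionMatrix w) where
  nonneg a a' := Finset.sum_nonneg fun s _ => mul_nonneg ENNReal.toReal_nonneg (choice_nonneg hw s a')
  row_sum a := by
    simp only [actionMatrix]
    rw [Finset.sum_comm]
    simp [← Finset.mul_sum, sum_choice hw, sum_δ]
  eq_univ Z hne hZ := hG.eq_univ hne fun a ha s hs a' ha' => hZ a ha a' <| by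
    refine (mul_pos (ENNReal.toReal_pos hs.ne' ((G.δ a).apply_ne_top s))
      (choice_pos hw ha')).trans_le (Finset.single_le_sum
        (f := fun s => (G.δ a s).toReal * G.choice w s a')
        (fun s _ => mul_nonneg ENNReal.toReal_nonneg (choice_nonneg hw s a')) (Finset.mem_univ s))

/-- The flow equation makes the inflow into a state equal to the denominator of `choice` there, so
the two cancel. -/
theorem RecurrentFlow.vecMul_actionMatrix (hflow : G.RecurrentFlow w) (hw : ∀ a, 0 < w a) :
    w ᵥ* G.actionMatrix w = w := by
  classical
  ext a'
  obtain ⟨t, ht, hu⟩ := G.act_partition a'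
  simp only [vecMul, dotProduct, actionMatrix, Finset.mul_sum]
  rw [Finset.sum_comm]
  simp only [← mul_assoc, ← Finset.sum_mul, hflow _]
  rw [Finset.sum_eq_single t]
  · simp only [choice, ht, if_true]
    exact mul_div_cancel₀ _ (sum_act_pos hw t).ne'
  · intro s _ hs
    have : a' ∉ G.act s := fun h => hs (hu s h)
    simp [choice, this]
  · simp

/-- Take a stationary vector of the action chain under uniform choice; summing stationarity over the
actions of one state gives the flow equation. -/
theorem StronglyConnected.exists_pos_recurrentFlow [Nonempty A] (hG : G.StronglyConnected) :
    ∃ y : A → ℝ, (∀ a, 0 < y a) ∧ G.RecurrentFlow y := by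
  classical
  have h1 : ∀ _ : A, (0 : ℝ) < 1 := fun _ => one_pos
  obtain ⟨y, hy, hyQ⟩ := (hG.isIrreducibleStochastic h1).exists_pos_vecMul_eq
  refine ⟨y, hy, fun s => ?_⟩
  have : ∀ a ∈ G.act s, y a = (∑ b, y b * (G.δ b s).toReal) * G.choice (fun _ => 1) s a := by
    intro a ha
    obtain ⟨t, -, hu⟩ := G.act_partition a
    conv_lhs => rw [← hyQ]
    simp only [vecMul, dotProduct, actionMatrix, Finset.mul_sum]
    rw [Finset.sum_comm, Finset.sum_eq_single s]
    · simp [← mul_assoc, Finset.sum_mul]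
    · intro s' _ hs'
      have : a ∉ G.act s' := fun h => hs' ((hu s' h).trans (hu s ha).symm)
      simp [choice, this]
    · simp
  rw [Finset.sum_congr rfl this, ← Finset.mul_sum, sum_act_choice h1, mul_one]

theorem RecurrentFlow.add {x y : A → ℝ} (hx : G.RecurrentFlow x) (hy : G.RecurrentFlow y) :
    G.RecurrentFlow (x + y) := fun s => by
  simp only [Pi.add_apply, add_mul, Finset.sum_add_distrib, hx s, hy s]

theorem RecurrentFlow.smul {x : A → ℝ} (hx : G.RecurrentFlow x) (c : ℝ) :
    G.RecurrentFlow (c • x) := fun s => by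
  simp only [Pi.smul_apply, smul_eq_mul, mul_assoc, ← Finset.mul_sum, hx s]

end MDP

/-! ## Almost sure properties of the runs of a Markov chain -/

namespace MarkovChain

variable {L : Type*} [Countable L] [MeasurableSpace L] [DiscreteMeasurableSpace L]

theorem ae_toMeasure_of_forall_mem_support {p : PMF L} {P : L → Prop} (h : ∀ l ∈ p.support, P l) :
    ∀ᵐ l ∂p.toMeasure, P l := by
  rw [ae_iff, PMF.toMeasure_apply_eq_zero_iff _ (MeasurableSet.of_discrete)]
  exact Set.disjoint_left.2 fun l hl hP => hP (h l hl)

theorem map_law_zero (C : MarkovChain L) : C.law.map (fun ω => ω 0) = C.init.toMeasure := by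
  have : IsProbabilityMeasure C.init.toMeasure := PMF.toMeasure.isProbabilityMeasure _
  have h : C.law.map (Preorder.frestrictLe (π := fun _ => L) 0)
      = C.init.toMeasure.map (MeasurableEquiv.piUnique (fun _ : Finset.Iic 0 => L)).symm := by
    rw [law, Kernel.trajMeasure, Measure.map_comp _ _ (by fun_prop), Kernel.traj_map_frestrictLe,
      Kernel.partialTraj_self, Measure.id_comp]
  have h0 := congrArg (Measure.map (MeasurableEquiv.piUnique (fun _ : Finset.Iic 0 => L))) h
  rw [Measure.map_map (by fun_prop) (by fun_prop), Measure.map_map (by fun_prop) (by fun_prop)] at h0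
  have hd : ((default : Finset.Iic 0) : ℕ) = 0 := rfl
  simpa [Function.comp_def, hd] using h0

theorem ae_zero (C : MarkovChain L) {P : L → Prop} (h : ∀ l ∈ C.init.support, P l) :
    ∀ᵐ ω ∂C.law, P (ω 0) := by
  have := ae_toMeasure_of_forall_mem_support h
  rw [← C.map_law_zero] at this
  exact ae_of_ae_map (measurable_pi_apply 0).aemeasurable this

theorem ae_succ (C : MarkovChain L) {P : L → L → Prop} (h : ∀ l, ∀ l' ∈ (C.trans l).support, P l l')
    (n : ℕ) : ∀ᵐ ω ∂C.law, P (ω n) (ω (n + 1)) := by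
  have : IsProbabilityMeasure C.init.toMeasure := PMF.toMeasure.isProbabilityMeasure _
  have key := Kernel.map_frestrictLe_trajMeasure_compProd_eq_map_trajMeasure
    (X := fun _ => L) (μ₀ := C.init.toMeasure) (κ := C.stepKernel) (a := n)
  let last : Finset.Iic n := ⟨n, Finset.mem_Iic.2 le_rfl⟩
  have hP : MeasurableSet {p : ((i : Finset.Iic n) → L) × L | P (p.1 last) p.2} :=
    (by fun_prop : Measurable fun p : ((i : Finset.Iic n) → L) × L => (p.1 last, p.2))
      (MeasurableSet.of_discrete (s := {q : L × L | P q.1 q.2}))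
  have h1 := Measure.ae_compProd_of_ae_ae
    (μ := (Kernel.trajMeasure (X := fun _ => L) C.init.toMeasure C.stepKernel).map
      (Preorder.frestrictLe n)) (κ := C.stepKernel n) hP
    (ae_of_all _ fun h' => ae_toMeasure_of_forall_mem_support (h (h' last)))
  rw [key] at h1
  exact ae_of_ae_map (by fun_prop) h1

end MarkovChain

/-! ## Averages along slowly changing solutions of the Poisson equation -/

/-- A sequence of natural numbers that tends to infinity so slowly that `B` grows along it at most
like an eighth root. -/
theorem exists_slow_schedule (B : ℕ → ℕ) :
    ∃ κ : ℕ → ℕ, Monotone κ ∧ Tendsto κ atTop atTop ∧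
      ∃ K : ℝ, ∀ t : ℕ, (B (κ t) : ℝ) ^ 8 ≤ K * (t + 1) := by
  -- The default value 0 need not satisfy the bound; the term `B 0 ^ 8` in `K` covers it.
  let κ : ℕ → ℕ := fun t => Nat.findGreatest (fun k => B k ^ 8 ≤ t) t
  have hmono : Monotone κ := fun s t hst =>
    Nat.findGreatest_mono (fun k hk => hk.trans hst) hst
  refine ⟨κ, hmono, tendsto_atTop.2 fun k => ?_, (B 0 : ℝ) ^ 8 + 1, fun t => ?_⟩
  · filter_upwards [eventually_ge_atTop (max k (B k ^ 8))] with t ht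
    exact Nat.le_findGreatest ((le_max_left _ _).trans ht) ((le_max_right _ _).trans ht)
  · have hB0 : (0 : ℝ) ≤ (B 0 : ℝ) ^ 8 := by positivity
    have ht0 : (0 : ℝ) ≤ t := t.cast_nonneg
    by_cases h0 : κ t = 0
    · rw [h0]; nlinarith
    · have : B (κ t) ^ 8 ≤ t := Nat.findGreatest_of_ne_zero (P := fun k => B k ^ 8 ≤ t) rfl h0
      have : (B (κ t) : ℝ) ^ 8 ≤ t := by exact_mod_cast this
      nlinarith

/-- Summation by parts leaves two boundary terms and the changes from `h (κ n)` to `h (κ (n + 1))`.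
These vanish unless `κ` jumps, and there are at most `κ N - κ 0 ≤ c N` jumps, each costing at most
`2 * c N`. -/
theorem abs_sum_sub_le {A : Type*} {h : ℕ → A → ℝ} {κ : ℕ → ℕ} (hκ : Monotone κ) {c : ℕ → ℝ}
    (hc : Monotone c) (hh : ∀ n a, |h (κ n) a| ≤ c n) (hκc : ∀ n, (κ n : ℝ) ≤ c n) (a : ℕ → A)
    (N : ℕ) :
    |∑ n ∈ Finset.range N, (h (κ n) (a n) - h (κ n) (a (n + 1)))| ≤ 2 * c N + 2 * c N ^ 2 := by
  have hc0 (n : ℕ) : 0 ≤ c n := (Nat.cast_nonneg _).trans (hκc n)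
  have hstep (n : ℕ) (b : A) : |h (κ (n + 1)) b - h (κ n) b|
      ≤ 2 * c (n + 1) * ((κ (n + 1) : ℝ) - κ n) := by
    rcases (hκ n.le_succ).eq_or_lt with heq | hlt
    · simp only [Nat.succ_eq_add_one] at heq
      simp [heq]
    · have h1 : (1 : ℝ) ≤ (κ (n + 1) : ℝ) - κ n := by
        have : (κ n : ℝ) + 1 ≤ κ (n + 1) := by exact_mod_cast hlt
        linarith
      refine ((abs_sub _ _).trans (add_le_add (hh (n + 1) b) (hh n b))).trans ?_
      have := mul_le_mul_of_nonneg_left h1 (by linarith [hc0 (n + 1)] : 0 ≤ 2 * c (n + 1))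
      linarith [hc n.le_succ]
  have hind : |∑ n ∈ Finset.range N, (h (κ n) (a n) - h (κ n) (a (n + 1)))
      - (h (κ 0) (a 0) - h (κ N) (a N))| ≤ 2 * c N * ((κ N : ℝ) - κ 0) := by
    induction N with
    | zero => simp
    | succ N ih =>
      rw [Finset.sum_range_succ]
      have hsub : (0 : ℝ) ≤ (κ N : ℝ) - κ 0 := by
        have : (κ 0 : ℝ) ≤ κ N := by exact_mod_cast hκ N.zero_le
        linarith
      have h1 := mul_le_mul_of_nonneg_right (hc N.le_succ) hsub
      have h2 := hstep N (a (N + 1))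
      have h3 := abs_add_le (∑ n ∈ Finset.range N, (h (κ n) (a n) - h (κ n) (a (n + 1)))
        - (h (κ 0) (a 0) - h (κ N) (a N))) (h (κ (N + 1)) (a (N + 1)) - h (κ N) (a (N + 1)))
      calc _ = |(∑ n ∈ Finset.range N, (h (κ n) (a n) - h (κ n) (a (n + 1)))
            - (h (κ 0) (a 0) - h (κ N) (a N)))
            + (h (κ (N + 1)) (a (N + 1)) - h (κ N) (a (N + 1)))| := by congr 1; ring
        _ ≤ _ := by
          simp only [Nat.succ_eq_add_one] at h1
          linarith
  have h0 := (hh 0 (a 0)).trans (hc N.zero_le)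
  have hN := hh N (a N)
  have hκ0 : (0 : ℝ) ≤ κ 0 := Nat.cast_nonneg _
  have hbd : 2 * c N * ((κ N : ℝ) - κ 0) ≤ 2 * c N ^ 2 := by
    have := mul_le_mul_of_nonneg_left (by linarith [hκc N] : (κ N : ℝ) - κ 0 ≤ c N)
      (by linarith [hc0 N] : 0 ≤ 2 * c N)
    linarith [sq (c N)]
  have htri := abs_add_le (∑ n ∈ Finset.range N, (h (κ n) (a n) - h (κ n) (a (n + 1)))
    - (h (κ 0) (a 0) - h (κ N) (a N))) (h (κ 0) (a 0) - h (κ N) (a N))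
  rw [sub_add_cancel] at htri
  linarith [abs_sub (h (κ 0) (a 0)) (h (κ N) (a N))]

theorem tendsto_sum_sub_div {A : Type*} {h : ℕ → A → ℝ} {κ : ℕ → ℕ} (hκ : Monotone κ) {c : ℕ → ℝ}
    (hc : Monotone c) (hh : ∀ n a, |h (κ n) a| ≤ c n) (hκc : ∀ n, (κ n : ℝ) ≤ c n)
    (hc1 : ∀ n, 1 ≤ c n) {K : ℝ} (hcK : ∀ n, c n ^ 8 ≤ K * (n + 1)) (a : ℕ → A) :
    Tendsto (fun N : ℕ => (∑ n ∈ Finset.range (N + 1), (h (κ n) (a n) - h (κ n) (a (n + 1))))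
      / ((N : ℝ) + 1)) atTop (nhds 0) := by
  -- The fourth power is at most `K (N + 2) / (N + 1) ^ 4 ≤ 2 K / (N + 1)`.
  have hlim : Tendsto (fun N : ℕ => c (N + 1) ^ 2 / ((N : ℝ) + 1)) atTop (nhds 0) := by
    refine tendsto_zero_of_pow_four ?_
    have hK : Tendsto (fun N : ℕ => 2 * K * (1 / ((N : ℝ) + 1))) atTop (nhds 0) := by
      simpa using tendsto_one_div_add_atTop_nhds_zero_nat.const_mul (2 * K)
    refine squeeze_zero (fun N => by positivity) (fun N => ?_) hK
    have h1 := hcK (N + 1)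
    push_cast at h1
    have hN : (1 : ℝ) ≤ (N : ℝ) + 1 := by linarith [N.cast_nonneg (α := ℝ)]
    have hK0 : 0 ≤ K := by
      have := (pow_nonneg (zero_le_one.trans (hc1 0)) 8).trans (hcK 0)
      simpa using this
    rw [div_pow, ← pow_mul, div_le_iff₀ (by positivity)]
    have h3 : (1 : ℝ) ≤ ((N : ℝ) + 1) ^ 2 := one_le_pow₀ hN
    have h2 : 2 * K * (1 / ((N : ℝ) + 1)) * ((N : ℝ) + 1) ^ 4
        = 2 * K * ((N : ℝ) + 1) * ((N : ℝ) + 1) ^ 2 := by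
      field_simp
    rw [h2]
    have h4 := mul_le_mul_of_nonneg_left h3 (by positivity : 0 ≤ 2 * K * ((N : ℝ) + 1))
    have h5 : K * ((N : ℝ) + 1 + 1) ≤ 2 * K * ((N : ℝ) + 1) := by nlinarith
    norm_num at h4 ⊢
    linarith
  have h4 : Tendsto (fun N : ℕ => 4 * (c (N + 1) ^ 2 / ((N : ℝ) + 1))) atTop (nhds 0) := by
    simpa using hlim.const_mul 4
  refine squeeze_zero_norm (fun N => ?_) h4
  have hN : (0 : ℝ) < (N : ℝ) + 1 := by positivity
  rw [Real.norm_eq_abs, abs_div, abs_of_pos hN, ← mul_div_assoc]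
  refine div_le_div_of_nonneg_right ((abs_sum_sub_le hκ hc hh hκc a (N + 1)).trans ?_) hN.le
  nlinarith [hc1 (N + 1)]

/-! ## The strategy -/

namespace MDP

open Matrix

variable {S A : Type*} [Fintype S] [Fintype A] (G : MDP S A)

/-- The choice of an enabled action in proportion to positive weights, as a distribution. -/
def choicePMF {w : A → ℝ} (hw : ∀ a, 0 < w a) (s : S) : PMF A :=
  PMF.ofFintype (fun a => ENNReal.ofReal (G.choice w s a)) <| by
    rw [← ENNReal.ofReal_sum_of_nonneg fun a _ => choice_nonneg hw s a, sum_choice hw,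
      ENNReal.ofReal_one]

/-- The Markov strategy that at time `m` chooses actions in proportion to the weights `w m`. -/
def proportionalStrategy {w : ℕ → A → ℝ} (hw : ∀ m a, 0 < w m a) : G.Strategy ℕ where
  update _ _ m := PMF.pure (m + 1)
  next s m := G.choicePMF (hw m) s
  next_enabled s m a h := by
    by_contra ha
    simp [choicePMF, choice, ha] at h
  init := PMF.pure 0

variable {G} {w : ℕ → A → ℝ} (hw : ∀ m a, 0 < w m a)

theorem proportionalStrategy_isMarkov : (G.proportionalStrategy hw).IsMarkov := fun a s n => by
  simp [proportionalStrategy]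

theorem play_init_mem {l : Location S ℕ A}
    (hl : l ∈ (G.play (G.proportionalStrategy hw)).init.support) : l.mem = 0 := by
  simp only [play, Strategy.enter, proportionalStrategy, PMF.pure_bind, PMF.support_map] at hl
  obtain ⟨a, -, rfl⟩ := hl
  rfl

theorem play_trans_mem {l l' : Location S ℕ A}
    (hl : l' ∈ ((G.play (G.proportionalStrategy hw)).trans l).support) :
    l'.mem = l.mem + 1 := by
  simp only [play, Strategy.enter, proportionalStrategy, PMF.pure_bind,
    PMF.mem_support_bind_iff, PMF.support_map] at hl
  obtain ⟨s, -, a, -, rfl⟩ := hl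
  rfl

theorem ae_mem_eq : ∀ᵐ ω ∂(G.play (G.proportionalStrategy hw)).law, ∀ n, (ω n).mem = n := by
  have h0 := (G.play (G.proportionalStrategy hw)).ae_zero (P := fun l => l.mem = 0)
    fun _ hl => play_init_mem hw hl
  have h1 := ae_all_iff.2 fun n => (G.play (G.proportionalStrategy hw)).ae_succ
    (P := fun l l' => l'.mem = l.mem + 1) (fun _ _ hl => play_trans_mem hw hl) n
  filter_upwards [h0, h1] with ω h0 h1 n
  induction n with
  | zero => exact h0
  | succ n ih => rw [h1, ih]

/-- The memory is updated before the next action is drawn, whence the index `l.mem + 1`. -/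
theorem integral_action_trans (f : A → ℝ) (l : Location S ℕ A) :
    ∫ l', f l'.action ∂((G.play (G.proportionalStrategy hw)).trans l).toMeasure
      = (G.actionMatrix (w (l.mem + 1)) *ᵥ f) l.action := by
  let _ : MeasurableSpace A := ⊤
  have : DiscreteMeasurableSpace A := ⟨fun _ => trivial⟩
  have hmap : ((G.play (G.proportionalStrategy hw)).trans l).map Location.action
      = (G.δ l.action).bind fun s => G.choicePMF (hw (l.mem + 1)) s := by
    simp only [play, Strategy.enter, proportionalStrategy, PMF.pure_bind, PMF.map_bind,
      PMF.map_comp]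
    congr 1
    funext s
    exact PMF.map_id _
  have hmeas : Measurable (Location.action : Location S ℕ A → A) := Measurable.of_discrete
  rw [← integral_map (f := f) hmeas.aemeasurable Measurable.of_discrete.aestronglyMeasurable,
    PMF.toMeasure_map _ _ hmeas, hmap, PMF.integral_eq_sum]
  simp only [mulVec, dotProduct, actionMatrix]
  refine Finset.sum_congr rfl fun a _ => ?_
  rw [PMF.bind_apply, tsum_fintype, ENNReal.toReal_sum fun s _ =>
    ENNReal.mul_ne_top ((G.δ _).apply_ne_top s) (PMF.apply_ne_top _ _), smul_eq_mul]
  congr 1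
  refine Finset.sum_congr rfl fun s _ => ?_
  simp [choicePMF, choice_nonneg (hw (l.mem + 1)) s a]

/-- If the actions are chosen in proportion to weights `w (κ m)` whose Poisson equations have
solutions that change slowly along `κ`, then the averages follow the stationary means. -/
theorem ae_tendsto_average {w : ℕ → A → ℝ} (hw : ∀ k a, 0 < w k a) {κ : ℕ → ℕ} (hκ : Monotone κ)
    (hκt : Tendsto κ atTop atTop) {f : A → ℝ} {p : ℕ → ℝ} {q : ℝ} (hp : Tendsto p atTop (nhds q))
    {h : ℕ → A → ℝ} (hh : ∀ k a, h k a - (G.actionMatrix (w k) *ᵥ h k) a = f a - p k)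
    {B : ℕ → ℕ} (hB : Monotone B) (hBk : ∀ k, k + 1 ≤ B k) (hhB : ∀ k a, |h k a| ≤ B k)
    {K : ℝ} (hK : ∀ t : ℕ, (B (κ t) : ℝ) ^ 8 ≤ K * (t + 1)) :
    ∀ᵐ ω ∂(G.play (G.proportionalStrategy fun m => hw (κ m))).law,
      Tendsto (fun T : ℕ => (1 / (T : ℝ)) * ∑ t ∈ Finset.range T, f (ω t).action)
        atTop (nhds q) := by
  let C := G.play (G.proportionalStrategy fun m => hw (κ m))
  -- The transition out of location `n` uses the weights of time `n + 1`.
  let η : ℕ → ℕ := fun n => κ (n + 1)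
  let c : ℕ → ℝ := fun n => B (η n)
  let g : ℕ → Location S ℕ A → ℝ := fun n l => h (η n) l.action
  have hη : Monotone η := fun m n hmn => hκ (Nat.succ_le_succ hmn)
  have hc : Monotone c := fun m n hmn => Nat.cast_le.2 (hB (hη hmn))
  have hK0 : 0 ≤ K := by simpa using (by positivity : (0 : ℝ) ≤ (B (κ 0) : ℝ) ^ 8).trans (hK 0)
  have hcK (n : ℕ) : c n ^ 8 ≤ 2 * K * (n + 1) := by
    have := hK (n + 1)
    push_cast at this
    have hn : (0 : ℝ) ≤ n := n.cast_nonneg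
    exact this.trans (by nlinarith)
  have hBη (n : ℕ) : (η n : ℝ) + 1 ≤ c n := by
    simp only [c]
    exact_mod_cast hBk (η n)
  filter_upwards [ae_mem_eq fun m => hw (κ m),
    C.ae_tendsto_deviationSum_div hc (g := g) (fun n l => hhB _ _) hcK] with ω hmem hdev
  have hrem := tendsto_sum_sub_div hη hc (fun n a => hhB (η n) a)
    (fun n => by linarith [hBη n]) (fun n => by linarith [hBη n, (η n).cast_nonneg (α := ℝ)])
    hcK fun n => (ω n).action
  have hmean : Tendsto (fun N : ℕ => (∑ n ∈ Finset.range (N + 1), p (η n)) / ((N : ℝ) + 1))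
      atTop (nhds q) := by
    have := (tendsto_add_atTop_iff_nat 1).2
      (hp.comp (hκt.comp (tendsto_add_atTop_nat 1))).cesaro
    refine this.congr fun N => ?_
    simp [η, div_eq_inv_mul]
  refine (tendsto_add_atTop_iff_nat 1).1 ?_
  have hlim := (hmean.add hdev).add hrem
  simp only [add_zero] at hlim
  refine hlim.congr fun N => ?_
  rw [← add_div, ← add_div, MarkovChain.deviationSum, ← Finset.sum_add_distrib,
    ← Finset.sum_add_distrib, div_eq_inv_mul, one_div]
  push_cast
  congr 1
  refine Finset.sum_congr rfl fun n _ => ?_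
  have hint := integral_action_trans (G := G) (fun m => hw (κ m)) (h (η n)) (ω n)
  rw [hmem n] at hint
  have hpo := hh (η n) (ω n).action
  simp only [MarkovChain.deviation, g, C, hint]
  linarith

end MDP

end

theorem mainTheorem11 {S A : Type*} [Fintype S] [Fintype A] (G : MDP S A)
    (hG : G.StronglyConnected) (x : A → ℝ) (hx : ∀ a, 0 ≤ x a) (hflow : G.RecurrentFlow x)
    (hpos : 0 < ∑ a, x a) :
    ∃ ξ : G.Strategy ℕ, ξ.IsMarkov ∧
      ∀ a, ∀ᵐ ω ∂(G.play ξ).law, MDP.freq a ω = x a / ∑ b, x b := by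
  classical
  have : Nonempty A := by
    by_contra hA
    rw [not_nonempty_iff] at hA
    simp at hpos
  obtain ⟨y, hy, hyflow⟩ := hG.exists_pos_recurrentFlow
  let w : ℕ → A → ℝ := fun k => x + (1 / ((k : ℝ) + 1)) • y
  have hw (k a) : 0 < w k a := add_pos_of_nonneg_of_pos (hx a) (mul_pos (by positivity) (hy a))
  have hwlim (a) : Tendsto (fun k => w k a) atTop (nhds (x a)) := by
    simpa [w] using (tendsto_one_div_add_atTop_nhds_zero_nat.mul_const (y a)).const_add (x a)
  have hsum (k) : 0 < ∑ a, w k a := Finset.sum_pos (fun a _ => hw k a) Finset.univ_nonempty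
  let π : ℕ → A → ℝ := fun k => (∑ a, w k a)⁻¹ • w k
  have hπlim (b) : Tendsto (fun k => π k b) atTop (nhds (x b / ∑ a, x a)) := by
    rw [div_eq_inv_mul]
    exact ((tendsto_finsetSum _ fun a _ => hwlim a).inv₀ hpos.ne').mul (hwlim b)
  have hπ (k) : Matrix.vecMul (π k) (G.actionMatrix (w k)) = π k := by
    rw [Matrix.smul_vecMul, (hflow.add (hyflow.smul _)).vecMul_actionMatrix (hw k)]
  have hπ1 (k) : ∑ a, π k a = 1 := by
    simp only [π, Pi.smul_apply, smul_eq_mul, ← Finset.mul_sum]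
    exact inv_mul_cancel₀ (hsum k).ne'
  choose h hh using fun (k : ℕ) (b : A) =>
    (hG.isIrreducibleStochastic (hw k)).exists_poisson (hπ k) (hπ1 k) (Set.indicator {b} 1)
  have hind (k b) : ∑ a, π k a * Set.indicator {b} (1 : A → ℝ) a = π k b := by
    simp [Set.indicator_apply]
  simp only [hind] at hh
  -- Summing over `b` lets one schedule, hence one strategy, serve all actions; partial sums over
  -- `j` make `B` monotone, and the `+ 1` gives `k + 1 ≤ B k`.
  let B : ℕ → ℕ := fun k => ∑ j ∈ Finset.range (k + 1), (⌈∑ b, ∑ a, |h j b a|⌉₊ + 1)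
  have hB : Monotone B := fun k l hkl =>
    Finset.sum_le_sum_of_subset (Finset.range_mono (Nat.succ_le_succ hkl))
  have hBk (k) : k + 1 ≤ B k := by
    simpa using Finset.card_nsmul_le_sum (Finset.range (k + 1))
      (fun j => ⌈∑ b, ∑ a, |h j b a|⌉₊ + 1) 1 fun j _ => Nat.le_add_left _ _
  have hhB (b k a) : |h k b a| ≤ B k := by
    have h1 : |h k b a| ≤ ∑ b, ∑ a, |h k b a| :=
      (Finset.single_le_sum (f := fun a => |h k b a|) (fun _ _ => abs_nonneg _)
        (Finset.mem_univ a)).trans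
      (Finset.single_le_sum (f := fun b => ∑ a, |h k b a|)
        (fun _ _ => Finset.sum_nonneg fun _ _ => abs_nonneg _) (Finset.mem_univ b))
    have h2 : ⌈∑ b, ∑ a, |h k b a|⌉₊ + 1 ≤ B k :=
      Finset.single_le_sum (f := fun j => ⌈∑ b, ∑ a, |h j b a|⌉₊ + 1) (fun _ _ => Nat.zero_le _)
        (Finset.self_mem_range_succ k)
    exact (h1.trans (Nat.le_ceil _)).trans (Nat.cast_le.2 ((Nat.le_succ _).trans h2))
  obtain ⟨κ, hκ, hκt, K, hK⟩ := exists_slow_schedule B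
  refine ⟨G.proportionalStrategy fun m => hw (κ m), MDP.proportionalStrategy_isMarkov _,
    fun b => ?_⟩
  filter_upwards [MDP.ae_tendsto_average hw hκ hκt (hπlim b) (fun k a => hh k b a) hB hBk (hhB b) hK]
    with ω hω
  exact hω.liminf_eq
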